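/- Let $q\ge 2$ be an integer and let $\mathcal Q=(\mathcal P,\mathcal L,\mathrm I)$ be a generalized quadrangle of order $(q,q)$, i.e. an incidence structure with nonempty sets of points and lines in which every line is incident with exactly $q+1$ points, every point is incident with exactly $q+1$ lines, two distinct points are incident with at most one common line, and for every non-incident point-line pair $(x,\ell)$ there is a unique pair $(m,y)\in\mathcal L\times\mathcal P$ with $x\,\mathrm I\,m\,\mathrm I\,y\,\mathrm I\,\ell$. Let $P$ be a point and let $e_0$ be a line through $P$. Delete $P$, all points incident with some line through $P$, and all lines incident with some point of $e_0$ (including $e_0$ itself). Let $\mathcal C_q$ be the incidence graph of the remaining points and lines: its vertices are these points and lines, and a point is adjacent to a line exactly when they are incident. Then $\mathcal C_q$ is a finite $q$-regular graph with exactly $2q^3$ vertices and girth $8$, and every edge of $\mathcal C_q$ is contained in exactly $(q-1)^2\bigl((q-2)^2+1\bigr)$ distinct $8$-cycles; that is, $\mathcal C_q$ is an $egr\bigl(2q^3,\,q,\,8,\,(q-1)^2((q-2)^2+1)\bigr)$. In particular, if a generalized quadrangle of order $(q,q)$ exists, then there exists an $egr\bigl(2q^3,\,q,\,8,\,(q-1)^2((q-2)^2+1)\bigr)$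 graph. -/

import Mathlib

universe u v

/-- The incidence structure with point set `Pt`, line set `Ln` and incidence relation `I` is a
generalized quadrangle of order `(s, t)`: every line carries exactly `s + 1` points, every point
lies on exactly `t + 1` lines, two distinct points lie on at most one common line (equivalently,
two distinct lines meet in at most one point), and for every non-incident point-line pair `(x, l)`
there is a unique pair `(m, y)` with `x I m I y I l`. -/
structure IsGeneralizedQuadrangle {Pt : Type u} {Ln : Type v} (I : Pt → Ln → Prop) (s t : ℕ) :
    Prop where
  nonempty_points : Nonempty Pt
  nonempty_lines : Nonempty Ln
  one_le_s : 1 ≤ s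
  one_le_t : 1 ≤ t
  points_on_line : ∀ l : Ln, {x : Pt | I x l}.ncard = s + 1
  lines_through_point : ∀ x : Pt, {l : Ln | I x l}.ncard = t + 1
  eq_or_eq : ∀ (x y : Pt) (l m : Ln), I x l → I y l → I x m → I y m → x = y ∨ l = m
  existsUnique_proj : ∀ (x : Pt) (l : Ln), ¬ I x l →
    ∃! p : Ln × Pt, I x p.1 ∧ I p.2 p.1 ∧ I p.2 l

/-- The incidence (Levi) graph: vertices are the points and the lines, and a point is adjacent to
a line exactly when they are incident. -/
def incidenceGraph {Pt : Type u} {Ln : Type v} (I : Pt → Ln → Prop) : SimpleGraph (Pt ⊕ Ln) where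
  Adj
    | Sum.inl x, Sum.inr l => I x l
    | Sum.inr l, Sum.inl x => I x l
    | _, _ => False
  symm := ⟨by
    rintro (x | l) (y | m) h
    · exact h
    · exact h
    · exact h
    · exact h⟩
  loopless := ⟨by
    rintro (x | l) h
    · exact h
    · exact h⟩

/-- What is left after deleting the point `P`, all points on the lines through `P`, and all lines
incident with some point of the line `e₀`. -/
def remaining {Pt : Type u} {Ln : Type v} (I : Pt → Ln → Prop) (P : Pt) (e₀ : Ln) :
    Set (Pt ⊕ Ln) :=
  {w | (∃ x : Pt, w = Sum.inl x ∧ x ≠ P ∧ ∀ l : Ln, I P l → ¬ I x l) ∨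
    (∃ m : Ln, w = Sum.inr m ∧ ∀ x : Pt, I x e₀ → ¬ I x m)}

/-- The incidence graph of the structure that is left after the deletion. -/
def deletedGraph {Pt : Type u} {Ln : Type v} (I : Pt → Ln → Prop) (P : Pt) (e₀ : Ln) :
    SimpleGraph (remaining I P e₀) :=
  (incidenceGraph I).induce (remaining I P e₀)

/-- The cycles of length `g` of `G`, each one taken as a subgraph, so that neither a starting
vertex nor an orientation is recorded. -/
def cyclesOfLength {V : Type u} (G : SimpleGraph V) (g : ℕ) : Set G.Subgraph :=
  {C | ∃ (a : V) (w : G.Walk a a), w.IsCycle ∧ w.length = g ∧ w.toSubgraph = C}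

/-- `G` is an `egr(n, k, g, lam)`: a finite `k`-regular graph of order `n` and girth `g`, each of
whose edges is contained in exactly `lam` distinct cycles of length `g`. -/
structure IsEdgeGirthRegular {V : Type u} (G : SimpleGraph V) (n k g lam : ℕ) : Prop where
  finite : Finite V
  order : Nat.card V = n
  regular : ∀ a : V, (G.neighborSet a).ncard = k
  girth : G.egirth = (g : ℕ∞)
  cycles_through_edge : ∀ e ∈ G.edgeSet, {C ∈ cyclesOfLength G g | e ∈ C.edgeSet}.ncard = lam

/-! The survivors are the points not collinear with `P` and the lines not meeting `e₀`. These
conditions are dual to each other, so every count for points yields one for lines. A surviving point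
ends a unique path from `P` along `e₀`, which gives `q ^ 3` of them, and it loses only the line
projecting it onto `e₀`; hence order and regularity. Digons and triangles are excluded, so the girth
is at least 8.

For the octagons through a flag `x I l`, continue to a line `m` and a point `y` in `(q - 1) ^ 2`
ways, then choose a surviving `a ≠ x` on `l` and `n ≠ m` through `y`, again in `(q - 1) ^ 2` ways.
Since `a` is off `n`, a unique path `a, k, b, n` closes the octagon. It is lost exactly when `k`
meets `e₀` or `b` is collinear with `P`. Each defect occurs for `q - 2` pairs (`ncard_bad_line` and
its dual), never both at once, leaving `(q - 1) ^ 2 - 2 (q - 2) = (q - 2) ^ 2 + 1`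
(`ncard_completions`). As this is positive, the girth is 8. -/

/-- The points not collinear with `P`. -/
def NonCollinear {Pt : Type u} {Ln : Type v} (I : Pt → Ln → Prop) (P : Pt) (x : Pt) : Prop :=
  ∀ l : Ln, I P l → ¬ I x l

theorem Set.ncard_setOf_and_ne {α : Type*} {p : α → Prop} {a : α} (h : p a) :
    {b | p b ∧ b ≠ a}.ncard = {b | p b}.ncard - 1 :=
  Set.ncard_sdiff_singleton_of_mem (s := {b | p b}) h

/-- If every fiber over `A` of a relation has `k` elements, then its graph has `|A| * k`. -/
theorem Set.ncard_setOf_prod {α β : Type*} [Finite α] [Finite β] {A : Set α}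
    {r : α → β → Prop} {k n : ℕ} (hA : A.ncard = n) (hr : ∀ a ∈ A, {b | r a b}.ncard = k) :
    {p : α × β | p.1 ∈ A ∧ r p.1 p.2}.ncard = n * k := by
  classical
  have := Fintype.ofFinite α
  have := Fintype.ofFinite β
  have h1 : {p : α × β | p.1 ∈ A ∧ r p.1 p.2} =
      ↑(A.toFinset.biUnion fun a => ({b | r a b}.toFinset).image (Prod.mk a)) := by
    ext ⟨a, b⟩; simp [and_comm]
  rw [h1, Set.ncard_coe_finset, Finset.card_biUnion, Finset.sum_congr rfl (g := fun _ => k),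
    Finset.sum_const, ← Set.ncard_eq_toFinset_card', hA, smul_eq_mul]
  · intro a ha
    rw [Finset.card_image_of_injective _ (Prod.mk_right_injective a), ← Set.ncard_eq_toFinset_card']
    exact hr a (by simpa using ha)
  · intro a _ b _ hab
    simp only [Function.onFun, Finset.disjoint_left, Finset.mem_image]
    grind

/-! ### Projections, duality and finiteness. -/

namespace IsGeneralizedQuadrangle

variable {Pt : Type u} {Ln : Type v} {I : Pt → Ln → Prop} {s t q : ℕ}

theorem proj_unique (h : IsGeneralizedQuadrangle I s t) {x : Pt} {l m m' : Ln} {y y' : Pt}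
    (hx : ¬ I x l) (h1 : I x m) (h2 : I y m) (h3 : I y l) (h1' : I x m') (h2' : I y' m')
    (h3' : I y' l) : m = m' ∧ y = y' := by
  have := (h.existsUnique_proj x l hx).unique (y₁ := (m, y)) (y₂ := (m', y')) ⟨h1, h2, h3⟩
    ⟨h1', h2', h3'⟩
  simpa using this

theorem exists_proj (h : IsGeneralizedQuadrangle I s t) {x : Pt} {l : Ln} (hx : ¬ I x l) :
    ∃ m y, I x m ∧ I y m ∧ I y l := by
  obtain ⟨⟨m, y⟩, h, -⟩ := h.existsUnique_proj x l hx
  exact ⟨m, y, h⟩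

/-- Duality turns the flag `(P, e₀)` into `(e₀, P)` and so exchanges the two kinds of survivors. -/
theorem dual (h : IsGeneralizedQuadrangle I s t) :
    IsGeneralizedQuadrangle (fun l x => I x l) t s where
  nonempty_points := h.nonempty_lines
  nonempty_lines := h.nonempty_points
  one_le_s := h.one_le_t
  one_le_t := h.one_le_s
  points_on_line := h.lines_through_point
  lines_through_point := h.points_on_line
  eq_or_eq := fun x y l m h1 h2 h3 h4 => (h.eq_or_eq l m x y h1 h3 h2 h4).symm
  existsUnique_proj := by
    intro l x hx
    obtain ⟨m, y, h1, h2, h3⟩ := h.exists_proj hx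
    refine ⟨(y, m), ⟨h3, h2, h1⟩, ?_⟩
    rintro ⟨y', m'⟩ ⟨h3', h2', h1'⟩
    obtain ⟨rfl, rfl⟩ := h.proj_unique hx h1 h2 h3 h1' h2' h3'
    rfl

theorem finite_points (h : IsGeneralizedQuadrangle I s t) : Finite Pt := by
  -- `ncard` is 0 on infinite sets, so a positive value forces finiteness.
  have hP : ∀ l, {x : Pt | I x l}.Finite := fun l =>
    Set.finite_of_ncard_pos (by rw [h.points_on_line]; omega)
  have hL : ∀ x, {l : Ln | I x l}.Finite := fun x =>
    Set.finite_of_ncard_pos (by rw [h.lines_through_point]; omega)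
  obtain ⟨l⟩ := h.nonempty_lines
  have key : (⋃ y ∈ {y | I y l}, ⋃ m ∈ {m | I y m}, {x | I x m}).Finite :=
    (hP l).biUnion fun y _ => (hL y).biUnion fun m _ => hP m
  refine Set.finite_univ_iff.1 (key.subset fun x _ => ?_)
  simp only [Set.mem_iUnion, Set.mem_ofPred_eq, exists_prop]
  by_cases hx : I x l
  · exact ⟨x, hx, l, hx, hx⟩
  · obtain ⟨m, y, h1, h2, h3⟩ := h.exists_proj hx
    exact ⟨y, h3, m, h2, h1⟩

theorem finite_lines (h : IsGeneralizedQuadrangle I s t) : Finite Ln := h.dual.finite_points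

/-! ### Counting around the flag `(P, e₀)`. -/

variable {P : Pt} {e₀ : Ln}

/-- Through a point not collinear with `P ∈ e₀`, all lines but one miss `e₀`. -/
theorem ncard_lines (h : IsGeneralizedQuadrangle I s t) (hPe : I P e₀) {x : Pt}
    (hx : NonCollinear I P x) :
    {l | I x l ∧ NonCollinear (fun l x => I x l) e₀ l}.ncard = t := by
  have := h.finite_lines
  obtain ⟨m, y, h1, h2, h3⟩ := h.exists_proj (hx e₀ hPe)
  have : {l | I x l ∧ NonCollinear (fun l x => I x l) e₀ l} = {l | I x l ∧ l ≠ m} := by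
    ext l
    refine and_congr_right fun a => ⟨fun b hl => b y h3 (hl ▸ h2), fun b z hz hz' => b ?_⟩
    exact (h.proj_unique (hx e₀ hPe) a hz' hz h1 h2 h3).1
  rw [this, Set.ncard_setOf_and_ne h1, h.lines_through_point, Nat.add_sub_cancel]

theorem ncard_points (h : IsGeneralizedQuadrangle I s t) (hPe : I P e₀) {l : Ln}
    (hl : NonCollinear (fun l x => I x l) e₀ l) :
    {x | I x l ∧ NonCollinear I P x}.ncard = s := h.dual.ncard_lines hPe hl

theorem ncard_lines_ne (h : IsGeneralizedQuadrangle I s t) (hPe : I P e₀) {x : Pt}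
    (hx : NonCollinear I P x) {m : Ln} (hm : I x m)
    (hm' : NonCollinear (fun l x => I x l) e₀ m) :
    {l | I x l ∧ NonCollinear (fun l x => I x l) e₀ l ∧ l ≠ m}.ncard = t - 1 := by
  rw [← h.ncard_lines hPe hx, ← Set.ncard_setOf_and_ne (a := m) ⟨hm, hm'⟩]
  simp only [and_assoc]

theorem ncard_points_ne (h : IsGeneralizedQuadrangle I s t) (hPe : I P e₀) {l : Ln}
    (hl : NonCollinear (fun l x => I x l) e₀ l) {x : Pt} (hx : I x l) (hx' : NonCollinear I P x) :
    {a | I a l ∧ NonCollinear I P a ∧ a ≠ x}.ncard = s - 1 :=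
  h.dual.ncard_lines_ne hPe hl hx hx'

/-- Projecting `x` onto `e₀` gives a path `e₀, w, k, x` with `w ≠ P`, `k ≠ e₀`, `x ≠ w`. Conversely,
the end of such a path projects to `w`, hence is not collinear with `P`. The factors count `w`, `k`
and `x`. -/
theorem ncard_nonCollinear (h : IsGeneralizedQuadrangle I s t) (hPe : I P e₀) :
    {x | NonCollinear I P x}.ncard = s * t * s := by
  have := h.finite_lines
  have := h.finite_points
  have h1 : {w | I w e₀ ∧ w ≠ P}.ncard = s := by
    rw [Set.ncard_setOf_and_ne (p := fun w => I w e₀) hPe, h.points_on_line, Nat.add_sub_cancel]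
  have h2 := Set.ncard_setOf_prod (r := fun w k => I w k ∧ k ≠ e₀) (k := t) h1 fun w hw => by
    rw [Set.ncard_setOf_and_ne hw.1, h.lines_through_point, Nat.add_sub_cancel]
  have h3 := Set.ncard_setOf_prod (r := fun (p : Pt × Ln) x => I x p.2 ∧ x ≠ p.1) (k := s) h2
    fun p hp => by
      rw [Set.ncard_setOf_and_ne (p := fun x => I x p.2) hp.2.1, h.points_on_line, Nat.add_sub_cancel]
  rw [← h3]
  clear h1 h2 h3
  symm
  have hoff : ∀ w k x, I w e₀ → I w k → k ≠ e₀ → I x k → x ≠ w → ¬ I x e₀ := by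
    intro w k x a b c d e f
    have := h.eq_or_eq x w k e₀ d b f a
    tauto
  refine Set.ncard_congr (fun p _ => p.2) ?_ ?_ ?_
  · rintro ⟨⟨w, k⟩, x⟩ ⟨⟨⟨a, b⟩, c, d⟩, e, f⟩ l hl hx
    simp only at *
    exact b (h.proj_unique (hoff w k x a c d e f) e c a hx hl hPe).2
  · rintro ⟨⟨w, k⟩, x⟩ ⟨⟨w', k'⟩, x'⟩ ⟨⟨⟨a, b⟩, c, d⟩, e, f⟩ ⟨⟨⟨a', b'⟩, c', d'⟩, e', f'⟩ rfl
    simp only at *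
    obtain ⟨rfl, rfl⟩ := h.proj_unique (hoff w k x a c d e f) e c a e' c' a'
    rfl
  · intro x hx
    have hx0 := hx e₀ hPe
    obtain ⟨m, y, h1, h2, h3⟩ := h.exists_proj hx0
    refine ⟨((y, m), x), ⟨⟨⟨h3, ?_⟩, h2, ?_⟩, h1, ?_⟩, rfl⟩
    · intro e; exact hx m (e ▸ h2) h1
    · intro e; exact hx0 (e ▸ h1)
    · rintro (rfl : x = y); exact hx0 h3

/-! ### Closing a path `l, x, m, y` to an octagon. -/

section completion

variable {l m : Ln} {x y : Pt}

/-- Pairs `(a, n)` completing the path `l, x, m, y` whose connecting line meets `e₀`. -/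
theorem ncard_bad_line (h : IsGeneralizedQuadrangle I s t) (hPe : I P e₀)
    (hl : NonCollinear (fun l x => I x l) e₀ l) (hx : NonCollinear I P x)
    (hm : NonCollinear (fun l x => I x l) e₀ m) (hy : NonCollinear I P y)
    (hxl : I x l) (hxm : I x m) (hym : I y m) (hxy : x ≠ y) (hlm : l ≠ m) :
    {p : Pt × Ln | (I p.1 l ∧ NonCollinear I P p.1 ∧ p.1 ≠ x) ∧
      (I y p.2 ∧ NonCollinear (fun l x => I x l) e₀ p.2 ∧ p.2 ≠ m) ∧
      ∃ k b, I p.1 k ∧ I b k ∧ I b p.2 ∧ ¬ NonCollinear (fun l x => I x l) e₀ k}.ncard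
      = s - 1 - 1 := by
  have hyl : ¬ I y l := fun hyl => by have := h.eq_or_eq x y l m hxl hyl hxm hym; tauto
  have hye := hy e₀ hPe
  -- With `z` the projection of `y` onto `e₀` and `a₀` that of `z` onto `l`, the claim is that each
  -- admissible `a ≠ a₀` belongs to exactly one bad pair and `a₀` to none.
  obtain ⟨r, z, hyr, hzr, hze⟩ := h.exists_proj hye
  have hzl : ¬ I z l := hl z hze
  obtain ⟨k₀, a₀, hzk, hak, hal⟩ := h.exists_proj hzl
  have hzP : z ≠ P := by rintro rfl; exact hy r hzr hyr
  have ha₀e : ¬ I a₀ e₀ := fun hh => hl a₀ hh hal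
  have ha₀ : NonCollinear I P a₀ := fun l' h1 h2 =>
    hzP (h.proj_unique ha₀e hak hzk hze h2 h1 hPe).2
  have ha₀x : a₀ ≠ x := by
    rintro rfl
    -- Otherwise `x`, `y`, `z` would form a triangle.
    exact hxy (h.proj_unique (hm z hze) hzr hyr hym hzk hak hxm).2.symm
  rw [← h.ncard_points_ne hPe hl hxl hx,
    ← Set.ncard_sdiff_singleton_of_mem (a := a₀) (show _ ∧ _ from ⟨hal, ha₀, ha₀x⟩)]
  have hyk : ∀ a k, I a l → a ≠ x → I a k → ¬ I y k := fun a k h1 h2 h3 h4 =>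
    h2 (h.proj_unique hyl h4 h3 h1 hym hxm hxl).2
  have hbad : ∀ k, ¬ NonCollinear (fun l x => I x l) e₀ k → ∃ z, I z e₀ ∧ I z k := by
    intro k hk; simpa [NonCollinear] using hk
  refine Set.ncard_congr (fun p _ => p.1) ?_ ?_ ?_
  · rintro ⟨a, n⟩ ⟨⟨h1, h2, h3⟩, ⟨h4, h5, h6⟩, k, b, h7, h8, h9, h10⟩
    refine ⟨⟨h1, h2, h3⟩, ?_⟩
    rintro rfl
    -- For `a = a₀` the line `k` must pass through `z`, so projecting `y` onto it forces `n = r`,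
    -- which meets `e₀`.
    obtain ⟨z', hz'e, hz'k⟩ := hbad k h10
    obtain ⟨rfl, rfl⟩ := h.proj_unique ha₀e h7 hz'k hz'e hak hzk hze
    obtain ⟨rfl, rfl⟩ := h.proj_unique (hyk _ _ h1 h3 h7) h4 h9 h8 hyr hzr hzk
    exact h5 _ hze hzr
  · rintro ⟨a, n⟩ ⟨a', n'⟩ ⟨⟨h1, h2, h3⟩, ⟨h4, h5, h6⟩, k, b, h7, h8, h9, h10⟩
      ⟨-, ⟨h4', h5', h6'⟩, k', b', h7', h8', h9', h10'⟩ rfl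
    simp only at *
    obtain ⟨z', hz'e, hz'k⟩ := hbad k h10
    obtain ⟨z'', hz''e, hz''k⟩ := hbad k' h10'
    obtain ⟨rfl, rfl⟩ := h.proj_unique (h2 e₀ hPe) h7 hz'k hz'e h7' hz''k hz''e
    obtain ⟨rfl, rfl⟩ := h.proj_unique (hyk _ _ h1 h3 h7) h4 h9 h8 h4' h9' h8'
    rfl
  · rintro a ⟨⟨h1, h2, h3⟩, h4⟩
    -- The witness: `k` projects `a` onto `e₀`, and `n` projects `y` onto `k`.
    obtain ⟨k, z', h5, h6, h7⟩ := h.exists_proj (h2 e₀ hPe)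
    obtain ⟨n, b, h8, h9, h10⟩ := h.exists_proj (hyk _ _ h1 h3 h5)
    refine ⟨(a, n), ⟨⟨h1, h2, h3⟩, ⟨h8, ?_, ?_⟩, k, b, h5, h10, h9, fun hk => hk z' h7 h6⟩, rfl⟩
    · intro z'' hz1 hz2
      -- If `n` met `e₀`, it would be `r`. Then either `b = z`, forcing `a = a₀`, or `b` is off `e₀`
      -- and `k = n` contains `y`.
      obtain ⟨rfl, rfl⟩ := h.proj_unique hye h8 hz2 hz1 hyr hzr hze
      by_cases hbe : I b e₀
      · obtain ⟨-, rfl⟩ := h.proj_unique hye h8 h9 hbe h8 hzr hze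
        exact h4 (h.proj_unique hzl h10 h5 h1 hzk hak hal).2
      · obtain ⟨rfl, -⟩ := h.proj_unique hbe h9 hz2 hze h10 h6 h7
        exact hyk _ _ h1 h3 h5 h8
    · rintro rfl
      have ham : ¬ I a n := fun hh => by have := h.eq_or_eq a x l n h1 hxl hh hxm; tauto
      obtain ⟨rfl, -⟩ := h.proj_unique ham h1 hxl hxm h5 h10 h9
      exact hl z' h7 h6

/-- All `(q - 1) ^ 2` pairs split into the good ones `D`, those with bad line `E` and those with bad
point `F`. -/
theorem ncard_completions (h : IsGeneralizedQuadrangle I q q) (hq : 2 ≤ q) (hPe : I P e₀)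
    (hl : NonCollinear (fun l x => I x l) e₀ l) (hx : NonCollinear I P x)
    (hm : NonCollinear (fun l x => I x l) e₀ m) (hy : NonCollinear I P y)
    (hxl : I x l) (hxm : I x m) (hym : I y m) (hxy : x ≠ y) (hlm : l ≠ m) :
    {p : Pt × Ln | (I p.1 l ∧ NonCollinear I P p.1 ∧ p.1 ≠ x) ∧
      (I y p.2 ∧ NonCollinear (fun l x => I x l) e₀ p.2 ∧ p.2 ≠ m) ∧
      ∃ k b, I p.1 k ∧ I b k ∧ I b p.2 ∧ NonCollinear (fun l x => I x l) e₀ k ∧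
        NonCollinear I P b}.ncard = (q - 2) ^ 2 + 1 := by
  have := h.finite_lines
  have := h.finite_points
  have hE := h.ncard_bad_line hPe hl hx hm hy hxl hxm hym hxy hlm
  -- Read backwards, `y, m, x, l` is a path of the same kind in the dual; the pairs come out
  -- swapped.
  have hF := h.dual.ncard_bad_line hPe hy hm hx hl hym hxm hxl hlm.symm hxy.symm
  have hA := h.ncard_points_ne hPe hl hxl hx
  have hN := h.ncard_lines_ne hPe hy hym hm
  have hAN := Set.ncard_setOf_prod (r := fun _ n => I y n ∧
    NonCollinear (fun l x => I x l) e₀ n ∧ n ≠ m) hA fun _ _ => hN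
  rw [← Set.ncard_image_of_injective _ Prod.swap_injective] at hF
  set E := {p : Pt × Ln | (I p.1 l ∧ NonCollinear I P p.1 ∧ p.1 ≠ x) ∧
      (I y p.2 ∧ NonCollinear (fun l x => I x l) e₀ p.2 ∧ p.2 ≠ m) ∧
      ∃ k b, I p.1 k ∧ I b k ∧ I b p.2 ∧ ¬ NonCollinear (fun l x => I x l) e₀ k} with hEdef
  set F := Prod.swap '' _ with hFdef
  set D := {p : Pt × Ln | (I p.1 l ∧ NonCollinear I P p.1 ∧ p.1 ≠ x) ∧
      (I y p.2 ∧ NonCollinear (fun l x => I x l) e₀ p.2 ∧ p.2 ≠ m) ∧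
      ∃ k b, I p.1 k ∧ I b k ∧ I b p.2 ∧ NonCollinear (fun l x => I x l) e₀ k ∧
        NonCollinear I P b} with hDdef
  have hF' : F = {p : Pt × Ln | (I p.1 l ∧ NonCollinear I P p.1 ∧ p.1 ≠ x) ∧
      (I y p.2 ∧ NonCollinear (fun l x => I x l) e₀ p.2 ∧ p.2 ≠ m) ∧
      ∃ k b, I p.1 k ∧ I b k ∧ I b p.2 ∧ ¬ NonCollinear I P b} := by
    ext ⟨a, n⟩
    simp only [hFdef, Set.mem_image, Set.mem_ofPred_eq, Prod.exists, Prod.swap_prod_mk]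
    constructor
    · rintro ⟨n', a', ⟨h1, h2, k, b, h3, h4, h5, h6⟩, h7⟩
      cases h7
      exact ⟨h2, h1, b, k, h5, h4, h3, h6⟩
    · rintro ⟨h2, h1, b, k, h5, h4, h3, h6⟩
      exact ⟨n, a, ⟨h1, h2, k, b, h3, h4, h5, h6⟩, rfl⟩
  have hyl : ¬ I y l := fun hyl => by have := h.eq_or_eq x y l m hxl hyl hxm hym; tauto
  have han : ∀ a n, I a l → a ≠ x → I y n → ¬ I a n := fun a n h1 h2 h3 h4 =>
    h2 (h.proj_unique hyl h3 h4 h1 hym hxm hxl).2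
  have hEF : Disjoint E F := by
    rw [hF', Set.disjoint_left]
    rintro ⟨a, n⟩ ⟨⟨h1, h2, h3⟩, ⟨h4, h5, h6⟩, k, b, h7, h8, h9, h10⟩
      ⟨-, -, k', b', h7', h8', h9', h10'⟩
    simp only at *
    obtain ⟨rfl, rfl⟩ := h.proj_unique (han a n h1 h3 h4) h7 h8 h9 h7' h8' h9'
    simp only [NonCollinear, not_forall, not_not] at h10 h10'
    obtain ⟨z, hz1, hz2⟩ := h10
    obtain ⟨r, hr1, hr2⟩ := h10'
    -- Both `k` and the line joining `b` to `P` project `b` onto `e₀`. They coincide, so `a` would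
    -- be collinear with `P`.
    obtain ⟨rfl, rfl⟩ := h.proj_unique (fun hh => h5 b hh h9) h8 hz2 hz1 hr2 hr1 hPe
    exact h2 _ hr1 h7
  have hDEF : Disjoint D (E ∪ F) := by
    rw [hF', Set.disjoint_left]
    rintro ⟨a, n⟩ ⟨⟨h1, h2, h3⟩, ⟨h4, h5, h6⟩, k, b, h7, h8, h9, h10, h11⟩
      (⟨-, -, k', b', h7', h8', h9', h10'⟩ | ⟨-, -, k', b', h7', h8', h9', h10'⟩)
    all_goals
      simp only at *
      obtain ⟨rfl, rfl⟩ := h.proj_unique (han a n h1 h3 h4) h7 h8 h9 h7' h8' h9'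
      contradiction
  have hU : D ∪ (E ∪ F) = {p : Pt × Ln | p.1 ∈ {a | I a l ∧ NonCollinear I P a ∧ a ≠ x} ∧
      (I y p.2 ∧ NonCollinear (fun l x => I x l) e₀ p.2 ∧ p.2 ≠ m)} := by
    rw [hF']
    ext ⟨a, n⟩
    constructor
    · rintro (⟨h1, h2, -⟩ | ⟨h1, h2, -⟩ | ⟨h1, h2, -⟩) <;> exact ⟨h1, h2⟩
    · rintro ⟨h1, h2⟩
      obtain ⟨k, b, h3, h4, h5⟩ := h.exists_proj (han a n h1.1 h1.2.2 h2.1)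
      by_cases hk : NonCollinear (fun l x => I x l) e₀ k
      · by_cases hb : NonCollinear I P b
        · exact Or.inl ⟨h1, h2, k, b, h3, h4, h5, hk, hb⟩
        · exact Or.inr (Or.inr ⟨h1, h2, k, b, h3, h4, h5, hb⟩)
      · exact Or.inr (Or.inl ⟨h1, h2, k, b, h3, h4, h5, hk⟩)
  have hc := Set.ncard_union_eq hDEF
  rw [hU, Set.ncard_union_eq hEF, hE, hF, hAN] at hc
  -- With `q = 2 + c` the subtractions vanish and the count is `(c + 1) ^ 2 - 2 c = c ^ 2 + 1`.
  obtain ⟨c, rfl⟩ := Nat.exists_eq_add_of_le hq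
  have e1 : 2 + c - 1 = c + 1 := by omega
  have e2 : 2 + c - 2 = c := by omega
  rw [e1] at hc
  rw [e2]
  simp only [Nat.add_sub_cancel] at hc
  nlinarith

end completion

/-! ### Octagons through a flag. -/

/-- The ways to complete the flag `x I l` to an octagon `l, x, m, y, n, b, k, a` in the incidence
graph of the points not collinear with `P` and the lines not meeting `e₀`. -/
def octagons (I : Pt → Ln → Prop) (P : Pt) (e₀ l : Ln) (x : Pt) :
    Set ((Ln × Pt) × (Ln × Pt) × (Ln × Pt)) :=
  {p | ((I x p.1.1 ∧ NonCollinear (fun l x => I x l) e₀ p.1.1 ∧ p.1.1 ≠ l) ∧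
        I p.1.2 p.1.1 ∧ NonCollinear I P p.1.2 ∧ p.1.2 ≠ x) ∧
      (I p.2.2.2 l ∧ NonCollinear I P p.2.2.2 ∧ p.2.2.2 ≠ x) ∧
      (I p.1.2 p.2.1.1 ∧ NonCollinear (fun l x => I x l) e₀ p.2.1.1 ∧ p.2.1.1 ≠ p.1.1) ∧
      I p.2.2.2 p.2.2.1 ∧ I p.2.1.2 p.2.2.1 ∧ I p.2.1.2 p.2.1.1 ∧
      NonCollinear (fun l x => I x l) e₀ p.2.2.1 ∧ NonCollinear I P p.2.1.2}

theorem not_incident_of_path (h : IsGeneralizedQuadrangle I s t) {l m n : Ln} {a x y : Pt}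
    (hal : I a l) (hxl : I x l) (hxm : I x m) (hym : I y m) (hyn : I y n) (hax : a ≠ x)
    (hlm : m ≠ l) (hxy : y ≠ x) : ¬ I a n := by
  have hyl : ¬ I y l := fun hyl => by have := h.eq_or_eq x y l m hxl hyl hxm hym; tauto
  exact fun h4 => hax (h.proj_unique hyl hyn h4 hal hym hxm hxl).2

/-- Forgetting `k` and `b` loses nothing, since they are recovered by projecting `a` onto `n`. -/
theorem ncard_octagons (h : IsGeneralizedQuadrangle I q q) (hq : 2 ≤ q) (hPe : I P e₀)
    {l : Ln} {x : Pt} (hl : NonCollinear (fun l x => I x l) e₀ l) (hx : NonCollinear I P x)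
    (hxl : I x l) : (octagons I P e₀ l x).ncard = (q - 1) ^ 2 * ((q - 2) ^ 2 + 1) := by
  have := h.finite_lines
  have := h.finite_points
  have h1 := Set.ncard_setOf_prod (r := fun m y => I y m ∧ NonCollinear I P y ∧ y ≠ x)
    (h.ncard_lines_ne hPe hx hxl hl) fun m hm => h.ncard_points_ne hPe hm.2.1 hm.1 hx
  have h2 := Set.ncard_setOf_prod (r := fun (c : Ln × Pt) (p : Pt × Ln) =>
      (I p.1 l ∧ NonCollinear I P p.1 ∧ p.1 ≠ x) ∧
      (I c.2 p.2 ∧ NonCollinear (fun l x => I x l) e₀ p.2 ∧ p.2 ≠ c.1) ∧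
      ∃ k b, I p.1 k ∧ I b k ∧ I b p.2 ∧ NonCollinear (fun l x => I x l) e₀ k ∧
        NonCollinear I P b) h1
    fun c hc => h.ncard_completions hq hPe hl hx hc.1.2.1 hc.2.2.1 hxl hc.1.1 hc.2.1
      hc.2.2.2.symm hc.1.2.2.symm
  rw [sq, ← h2]
  refine Set.ncard_congr (fun p _ => (p.1, p.2.2.2, p.2.1.1)) ?_ ?_ ?_
  · rintro ⟨⟨m, y⟩, ⟨n, b⟩, ⟨k, a⟩⟩ ⟨hc, ha, hn, h3, h4, h5, h6, h7⟩
    exact ⟨hc, ha, hn, k, b, h3, h4, h5, h6, h7⟩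
  · rintro ⟨⟨m, y⟩, ⟨n, b⟩, ⟨k, a⟩⟩ ⟨⟨m', y'⟩, ⟨n', b'⟩, ⟨k', a'⟩⟩ ⟨hc, ha, hn, h3, h4, h5, h6, h7⟩
      ⟨-, -, -, h3', h4', h5', -, -⟩ heq
    simp only [Prod.mk.injEq] at heq
    obtain ⟨⟨rfl, rfl⟩, rfl, rfl⟩ := heq
    simp only at *
    obtain ⟨rfl, rfl⟩ := h.proj_unique (h.not_incident_of_path ha.1 hxl hc.1.1 hc.2.1 hn.1 ha.2.2
      hc.1.2.2 hc.2.2.2) h3 h4 h5 h3' h4' h5'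
    rfl
  · rintro ⟨⟨m, y⟩, a, n⟩ ⟨hc, ha, hn, k, b, h3, h4, h5, h6, h7⟩
    exact ⟨((m, y), (n, b), (k, a)), ⟨hc, ha, hn, h3, h4, h5, h6, h7⟩, rfl⟩

end IsGeneralizedQuadrangle

/-! ### Cycles as subgraphs and as closed walks. -/

namespace SimpleGraph.Walk

variable {V : Type u} {G : SimpleGraph V} {u v : V}

theorem exists_eq_cons_of_length_eq_succ {n : ℕ} (w : G.Walk u v) (h : w.length = n + 1) :
    ∃ (z : V) (hz : G.Adj u z) (w' : G.Walk z v), w = cons hz w' ∧ w'.length = n := by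
  cases w with
  | nil => simp at h
  | cons hz w' => exact ⟨_, hz, w', rfl, by simpa using h⟩

/-- A cycle is determined by its subgraph, its starting vertex and its second vertex. -/
theorem IsCycle.ext_toSubgraph {w w' : G.Walk u u} (hw : w.IsCycle) (hw' : w'.IsCycle)
    (hlen : w.length = w'.length) (hsnd : w.snd = w'.snd) (hs : w.toSubgraph = w'.toSubgraph) :
    w = w' := by
  -- Induction on consecutive pairs: the subgraph neighbours of an inner vertex are its predecessor
  -- and successor, so the predecessor determines the successor.
  have key : ∀ k, k + 1 ≤ w.length →
      w.getVert k = w'.getVert k ∧ w.getVert (k + 1) = w'.getVert (k + 1) := by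
    intro k
    induction k with
    | zero => exact fun _ => ⟨by simp, hsnd⟩
    | succ k ih =>
      intro hk
      obtain ⟨h1, h2⟩ := ih (by omega)
      refine ⟨h2, ?_⟩
      have e := hw.neighborSet_toSubgraph_internal (i := k + 1) (by omega) (by omega)
      have e' := hw'.neighborSet_toSubgraph_internal (i := k + 1) (by omega) (by omega)
      rw [hs, h2, e', Nat.add_sub_cancel, h1] at e
      have hne := hw.getVert_sub_one_ne_getVert_add_one (i := k + 1) (by omega)
      rw [Nat.add_sub_cancel, h1] at hne
      have : w.getVert (k + 1 + 1) ∈ ({w'.getVert k, w'.getVert (k + 1 + 1)} : Set V) := by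
        rw [e]; simp
      rcases this with h | h
      · exact absurd h.symm hne
      · exact h
  refine ext_getVert_le_length hlen fun k hk => ?_
  rcases Nat.eq_zero_or_pos k with rfl | hk0
  · simp
  · obtain ⟨j, rfl⟩ : ∃ j, k = j + 1 := ⟨k - 1, by omega⟩
    exact (key j hk).2

end SimpleGraph.Walk

/-- The cycles through the edge `uv` correspond to the closed walks at `u` starting towards `v`. -/
theorem ncard_cyclesOfLength_through {V : Type u} {G : SimpleGraph V} (u v : V) (g : ℕ) :
    {C ∈ cyclesOfLength G g | s(u, v) ∈ C.edgeSet}.ncard =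
      {w : G.Walk u u | w.IsCycle ∧ w.length = g ∧ w.snd = v}.ncard := by
  classical
  symm
  refine Set.ncard_congr (fun w _ => w.toSubgraph) ?_ ?_ ?_
  · rintro w ⟨hw, hl, rfl⟩
    exact ⟨⟨u, w, hw, hl, rfl⟩, w.toSubgraph_adj_snd hw.not_nil⟩
  · rintro w w' ⟨hw, hl, hs⟩ ⟨hw', hl', hs'⟩ h
    exact hw.ext_toSubgraph hw' (hl.trans hl'.symm) (hs.trans hs'.symm) h
  · rintro C ⟨⟨a, w, hw, hl, rfl⟩, hadj⟩
    have hu : u ∈ w.support := w.fst_mem_support_of_mem_edges (w.mem_edges_toSubgraph.1 hadj)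
    have hmem : v ∈ (w.rotate u hu).toSubgraph.neighborSet u := by
      rw [w.toSubgraph_rotate hu]; exact hadj
    have hc := hw.rotate hu
    have hlr : (w.rotate u hu).length = g := by rw [SimpleGraph.Walk.length_rotate, hl]
    rw [hc.neighborSet_toSubgraph_endpoint] at hmem
    -- After rotation to `u`, the vertex `v` is either second or last but one; in the latter case
    -- the cycle is reversed.
    rcases hmem with h | h
    · exact ⟨_, ⟨hc, hlr, h.symm⟩, w.toSubgraph_rotate hu⟩
    · refine ⟨_, ⟨hc.reverse, by simpa using hlr, ?_⟩, ?_⟩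
      · rw [SimpleGraph.Walk.snd_reverse]; exact h.symm
      · rw [SimpleGraph.Walk.toSubgraph_reverse, w.toSubgraph_rotate hu]

/-! ### Short cycles in the incidence graph. -/

section incidenceGraph

variable {Pt : Type u} {Ln : Type v} {I : Pt → Ln → Prop} {s t q : ℕ}

theorem incidenceGraph_adj_inl {x : Pt} {z : Pt ⊕ Ln} (h : (incidenceGraph I).Adj (Sum.inl x) z) :
    ∃ l, z = Sum.inr l ∧ I x l := by
  rcases z with y | l
  · exact h.elim
  · exact ⟨l, rfl, h⟩

theorem incidenceGraph_adj_inr {l : Ln} {z : Pt ⊕ Ln} (h : (incidenceGraph I).Adj (Sum.inr l) z) :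
    ∃ x, z = Sum.inl x ∧ I x l := by
  rcases z with y | l
  · exact ⟨y, rfl, h⟩
  · exact h.elim

theorem IsGeneralizedQuadrangle.eq_of_triangle (h : IsGeneralizedQuadrangle I s t)
    {x y z : Pt} {l m n : Ln} (h1 : I x l) (h2 : I y l) (h3 : I y m) (h4 : I z m) (h5 : I z n)
    (h6 : I x n) : x = y ∨ l = m ∨ l = n := by
  by_cases hx : I x m
  · have := h.eq_or_eq x y l m h1 h2 hx h3
    tauto
  · exact Or.inr (Or.inr (h.proj_unique hx h1 h2 h3 h6 h5 h4).1)

/-- Points and lines alternate, so odd closed walks do not exist. Length 4 would be a digon and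
length 6 a triangle. -/
theorem IsGeneralizedQuadrangle.eight_le_length (h : IsGeneralizedQuadrangle I s t)
    {a : Pt ⊕ Ln} (w : (incidenceGraph I).Walk a a) (hw : w.IsCycle) : 8 ≤ w.length := by
  have h3 := hw.three_le_length
  by_contra! hlt
  have hadj : ∀ i, i < w.length → (incidenceGraph I).Adj (w.getVert i) (w.getVert (i + 1)) :=
    fun i hi => w.adj_getVert_succ hi
  have hinj : ∀ i j, i < j → j < w.length → w.getVert i ≠ w.getVert j := fun i j hij hj he =>
    hij.ne (hw.getVert_injOn' (by simp; omega) (by simp; omega) he)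
  have hlast : w.getVert w.length = w.getVert 0 := by simp
  have h0 := hadj 0 (by omega)
  have h1 := hadj 1 (by omega)
  have h2 := hadj 2 (by omega)
  rcases e0 : w.getVert 0 with x0 | l0
  · rw [e0] at h0
    obtain ⟨l1, e1, i0⟩ := incidenceGraph_adj_inl h0
    rw [e1] at h1
    obtain ⟨x2, e2, i1⟩ := incidenceGraph_adj_inr h1
    rw [e2] at h2
    obtain ⟨l3, e3, i2⟩ := incidenceGraph_adj_inl h2
    obtain hn | hn | hn | hn | hn : w.length = 3 ∨ w.length = 4 ∨ w.length = 5 ∨ w.length = 6 ∨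
        w.length = 7 := by omega
    · rw [hn, e3, e0] at hlast
      cases hlast
    · have h3 := hadj 3 (by omega)
      rw [e3] at h3
      obtain ⟨x4, e4, i3⟩ := incidenceGraph_adj_inr h3
      rw [hn, e4, e0] at hlast
      cases hlast
      have n1 := hinj 0 2 (by omega) (by omega)
      have n2 := hinj 1 3 (by omega) (by omega)
      rcases h.eq_or_eq _ _ _ _ i0 i1 i3 i2 with rfl | rfl
      · exact n1 (e0.trans e2.symm)
      · exact n2 (e1.trans e3.symm)
    · have h3 := hadj 3 (by omega)
      rw [e3] at h3
      obtain ⟨x4, e4, i3⟩ := incidenceGraph_adj_inr h3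
      have h4 := hadj 4 (by omega)
      rw [e4] at h4
      obtain ⟨l5, e5, i4⟩ := incidenceGraph_adj_inl h4
      rw [hn, e5, e0] at hlast
      cases hlast
    · have h3 := hadj 3 (by omega)
      rw [e3] at h3
      obtain ⟨x4, e4, i3⟩ := incidenceGraph_adj_inr h3
      have h4 := hadj 4 (by omega)
      rw [e4] at h4
      obtain ⟨l5, e5, i4⟩ := incidenceGraph_adj_inl h4
      have h5 := hadj 5 (by omega)
      rw [e5] at h5
      obtain ⟨x6, e6, i5⟩ := incidenceGraph_adj_inr h5
      rw [hn, e6, e0] at hlast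
      cases hlast
      have n1 := hinj 0 2 (by omega) (by omega)
      have n2 := hinj 1 3 (by omega) (by omega)
      have n3 := hinj 1 5 (by omega) (by omega)
      rcases h.eq_of_triangle i0 i1 i2 i3 i4 i5 with rfl | rfl | rfl
      · exact n1 (e0.trans e2.symm)
      · exact n2 (e1.trans e3.symm)
      · exact n3 (e1.trans e5.symm)
    · have h3 := hadj 3 (by omega)
      rw [e3] at h3
      obtain ⟨x4, e4, i3⟩ := incidenceGraph_adj_inr h3
      have h4 := hadj 4 (by omega)
      rw [e4] at h4
      obtain ⟨l5, e5, i4⟩ := incidenceGraph_adj_inl h4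
      have h5 := hadj 5 (by omega)
      rw [e5] at h5
      obtain ⟨x6, e6, i5⟩ := incidenceGraph_adj_inr h5
      have h6 := hadj 6 (by omega)
      rw [e6] at h6
      obtain ⟨l7, e7, i6⟩ := incidenceGraph_adj_inl h6
      rw [hn, e7, e0] at hlast
      cases hlast
  · rw [e0] at h0
    obtain ⟨x1, e1, i0⟩ := incidenceGraph_adj_inr h0
    rw [e1] at h1
    obtain ⟨l2, e2, i1⟩ := incidenceGraph_adj_inl h1
    rw [e2] at h2
    obtain ⟨x3, e3, i2⟩ := incidenceGraph_adj_inr h2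
    obtain hn | hn | hn | hn | hn : w.length = 3 ∨ w.length = 4 ∨ w.length = 5 ∨ w.length = 6 ∨
        w.length = 7 := by omega
    · rw [hn, e3, e0] at hlast
      cases hlast
    · have h3 := hadj 3 (by omega)
      rw [e3] at h3
      obtain ⟨l4, e4, i3⟩ := incidenceGraph_adj_inl h3
      rw [hn, e4, e0] at hlast
      cases hlast
      have n1 := hinj 0 2 (by omega) (by omega)
      have n2 := hinj 1 3 (by omega) (by omega)
      rcases h.eq_or_eq _ _ _ _ i0 i3 i1 i2 with rfl | rfl
      · exact n2 (e1.trans e3.symm)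
      · exact n1 (e0.trans e2.symm)
    · have h3 := hadj 3 (by omega)
      rw [e3] at h3
      obtain ⟨l4, e4, i3⟩ := incidenceGraph_adj_inl h3
      have h4 := hadj 4 (by omega)
      rw [e4] at h4
      obtain ⟨x5, e5, i4⟩ := incidenceGraph_adj_inr h4
      rw [hn, e5, e0] at hlast
      cases hlast
    · have h3 := hadj 3 (by omega)
      rw [e3] at h3
      obtain ⟨l4, e4, i3⟩ := incidenceGraph_adj_inl h3
      have h4 := hadj 4 (by omega)
      rw [e4] at h4
      obtain ⟨x5, e5, i4⟩ := incidenceGraph_adj_inr h4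
      have h5 := hadj 5 (by omega)
      rw [e5] at h5
      obtain ⟨l6, e6, i5⟩ := incidenceGraph_adj_inl h5
      rw [hn, e6, e0] at hlast
      cases hlast
      have n1 := hinj 0 2 (by omega) (by omega)
      have n2 := hinj 1 3 (by omega) (by omega)
      have n3 := hinj 2 4 (by omega) (by omega)
      rcases h.eq_of_triangle i1 i2 i3 i4 i5 i0 with rfl | rfl | rfl
      · exact n2 (e1.trans e3.symm)
      · exact n3 (e2.trans e4.symm)
      · exact n1 (e0.trans e2.symm)
    · have h3 := hadj 3 (by omega)
      rw [e3] at h3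
      obtain ⟨l4, e4, i3⟩ := incidenceGraph_adj_inl h3
      have h4 := hadj 4 (by omega)
      rw [e4] at h4
      obtain ⟨x5, e5, i4⟩ := incidenceGraph_adj_inr h4
      have h5 := hadj 5 (by omega)
      rw [e5] at h5
      obtain ⟨l6, e6, i5⟩ := incidenceGraph_adj_inl h5
      have h6 := hadj 6 (by omega)
      rw [e6] at h6
      obtain ⟨x7, e7, i6⟩ := incidenceGraph_adj_inr h6
      rw [hn, e7, e0] at hlast
      cases hlast

end incidenceGraph

/-! ### The deleted graph and its 8-cycles. -/

section deletedGraph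

variable {Pt : Type u} {Ln : Type v} {I : Pt → Ln → Prop} {P : Pt} {e₀ : Ln} {s t q : ℕ}

/-- A point not collinear with `P`, as a vertex of the deleted graph. -/
def ptVertex (hPe : I P e₀) (x : Pt) (hx : NonCollinear I P x) : remaining I P e₀ :=
  ⟨Sum.inl x, Or.inl ⟨x, rfl, fun h => hx e₀ hPe (h ▸ hPe), hx⟩⟩

/-- A line not meeting `e₀`, as a vertex of the deleted graph. -/
def lnVertex (P : Pt) (l : Ln) (hl : NonCollinear (fun l x => I x l) e₀ l) : remaining I P e₀ :=
  ⟨Sum.inr l, Or.inr ⟨l, rfl, hl⟩⟩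

theorem ptVertex_inj (hPe : I P e₀) {x y : Pt} {hx hy} :
    ptVertex hPe x hx = ptVertex hPe y hy ↔ x = y := by
  rw [Subtype.ext_iff]; exact Sum.inl_injective.eq_iff

theorem lnVertex_inj {l m : Ln} {hl hm} :
    (lnVertex P l hl : remaining I P e₀) = lnVertex P m hm ↔ l = m := by
  rw [Subtype.ext_iff]; exact Sum.inr_injective.eq_iff

theorem ptVertex_ne_lnVertex (hPe : I P e₀) {x : Pt} {l : Ln} {hx hl} :
    ptVertex hPe x hx ≠ lnVertex P l hl :=
  fun h => Sum.inl_ne_inr (congrArg Subtype.val h)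

theorem vertex_cases (hPe : I P e₀) (z : remaining I P e₀) :
    (∃ x hx, z = ptVertex hPe x hx) ∨ ∃ l hl, z = lnVertex P l hl := by
  obtain ⟨_, ⟨x, rfl, h, hx⟩ | ⟨l, rfl, hl⟩⟩ := z
  · exact Or.inl ⟨x, hx, rfl⟩
  · exact Or.inr ⟨l, hl, rfl⟩

theorem deletedGraph_adj_ptVertex (hPe : I P e₀) {x : Pt} {hx} {z : remaining I P e₀}
    (h : (deletedGraph I P e₀).Adj (ptVertex hPe x hx) z) :
    ∃ l hl, z = lnVertex P l hl ∧ I x l := by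
  rcases vertex_cases hPe z with ⟨y, hy, rfl⟩ | ⟨l, hl, rfl⟩
  · exact False.elim h
  · exact ⟨l, hl, rfl, h⟩

theorem deletedGraph_adj_lnVertex (hPe : I P e₀) {l : Ln} {hl} {z : remaining I P e₀}
    (h : (deletedGraph I P e₀).Adj (lnVertex P l hl) z) :
    ∃ x hx, z = ptVertex hPe x hx ∧ I x l := by
  rcases vertex_cases hPe z with ⟨y, hy, rfl⟩ | ⟨l, hl, rfl⟩
  · exact ⟨y, hy, rfl, h⟩
  · exact False.elim h

theorem deletedGraph_adj_of_incident (hPe : I P e₀) {x : Pt} {l : Ln} (h : I x l) (hx hl) :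
    (deletedGraph I P e₀).Adj (ptVertex hPe x hx) (lnVertex P l hl) := h

/-- The closed walk in the deleted graph given by an octagon. -/
def octagonWalk (hPe : I P e₀) {l : Ln} {x : Pt} (hl : NonCollinear (fun l x => I x l) e₀ l)
    (hx : NonCollinear I P x) (hxl : I x l) (p : (Ln × Pt) × (Ln × Pt) × (Ln × Pt))
    (hp : p ∈ IsGeneralizedQuadrangle.octagons I P e₀ l x) :
    (deletedGraph I P e₀).Walk (lnVertex P l hl) (lnVertex P l hl) :=
  .cons (deletedGraph_adj_of_incident hPe hxl hx hl).symm <|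
  .cons (deletedGraph_adj_of_incident hPe hp.1.1.1 hx hp.1.1.2.1) <|
  .cons (deletedGraph_adj_of_incident hPe hp.1.2.1 hp.1.2.2.1 hp.1.1.2.1).symm <|
  .cons (deletedGraph_adj_of_incident hPe hp.2.2.1.1 hp.1.2.2.1 hp.2.2.1.2.1) <|
  .cons (deletedGraph_adj_of_incident hPe hp.2.2.2.2.2.1 hp.2.2.2.2.2.2.2 hp.2.2.1.2.1).symm <|
  .cons (deletedGraph_adj_of_incident hPe hp.2.2.2.2.1 hp.2.2.2.2.2.2.2 hp.2.2.2.2.2.2.1) <|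
  .cons (deletedGraph_adj_of_incident hPe hp.2.2.2.1 hp.2.1.2.1 hp.2.2.2.2.2.2.1).symm <|
  .cons (deletedGraph_adj_of_incident hPe hp.2.1.1 hp.2.1.2.1 hl) .nil

/-- `octagons` demands only `m ≠ l`, `y ≠ x`, `a ≠ x` and `n ≠ m`; any other coincidence would
create a digon or a triangle. -/
theorem octagonWalk_isCycle (h : IsGeneralizedQuadrangle I s t) (hPe : I P e₀) {l : Ln} {x : Pt}
    (hl : NonCollinear (fun l x => I x l) e₀ l) (hx : NonCollinear I P x) (hxl : I x l)
    (p : (Ln × Pt) × (Ln × Pt) × (Ln × Pt)) (hp : p ∈ IsGeneralizedQuadrangle.octagons I P e₀ l x) :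
    (octagonWalk hPe hl hx hxl p hp).IsCycle := by
  have hp' := hp
  obtain ⟨⟨m, y⟩, ⟨n, b⟩, ⟨k, a⟩⟩ := p
  obtain ⟨⟨⟨h1, -, h2⟩, h3, -, h4⟩, ⟨h5, -, h6⟩, ⟨h7, -, h8⟩, h9, h10, h11, -, -⟩ := hp'
  simp only at *
  have han := h.not_incident_of_path h5 hxl h1 h3 h7 h6 h2 h4
  have hyl : ¬ I y l := fun hyl => by have := h.eq_or_eq x y l m hxl hyl h1 h3; tauto
  have c1 : k ≠ n := by rintro rfl; exact han h9
  have c2 : k ≠ l := by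
    rintro rfl; exact h8 (h.proj_unique hyl h7 h11 h10 h3 h1 hxl).1
  have c3 : k ≠ m := by
    rintro rfl; have := h.eq_or_eq a x l k h5 hxl h9 h1; tauto
  have c4 : n ≠ l := by rintro rfl; exact hyl h7
  have c5 : b ≠ a := by rintro rfl; exact han h11
  have c6 : b ≠ y := by
    rintro rfl; exact h6 (h.proj_unique hyl h10 h9 h5 h3 h1 hxl).2
  have c7 : b ≠ x := by
    rintro rfl; have := h.eq_or_eq b y m n h1 h3 h11 h7; tauto
  have c8 : a ≠ y := by rintro rfl; exact hyl h5
  rw [octagonWalk, SimpleGraph.Walk.cons_isCycle_iff]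
  simp only [SimpleGraph.Walk.cons_isPath_iff, SimpleGraph.Walk.support_cons,
    SimpleGraph.Walk.support_nil, SimpleGraph.Walk.edges_cons, SimpleGraph.Walk.edges_nil,
    SimpleGraph.Walk.IsPath.nil, List.mem_cons, List.not_mem_nil,
    Sym2.eq_iff, ptVertex_inj, lnVertex_inj, ptVertex_ne_lnVertex, (ptVertex_ne_lnVertex hPe).symm]
  grind

theorem ncard_cycleWalks (h : IsGeneralizedQuadrangle I q q) (hq : 2 ≤ q) (hPe : I P e₀)
    {l : Ln} {x : Pt} (hl : NonCollinear (fun l x => I x l) e₀ l) (hx : NonCollinear I P x)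
    (hxl : I x l) :
    {w : (deletedGraph I P e₀).Walk (lnVertex P l hl) (lnVertex P l hl) |
      w.IsCycle ∧ w.length = 8 ∧ w.snd = ptVertex hPe x hx}.ncard =
      (q - 1) ^ 2 * ((q - 2) ^ 2 + 1) := by
  rw [← h.ncard_octagons hq hPe hl hx hxl]
  symm
  refine Set.ncard_congr (octagonWalk hPe hl hx hxl) ?_ ?_ ?_
  · exact fun p hp => ⟨octagonWalk_isCycle h hPe hl hx hxl p hp, rfl, rfl⟩
  · rintro ⟨⟨m, y⟩, ⟨n, b⟩, ⟨k, a⟩⟩ ⟨⟨m', y'⟩, ⟨n', b'⟩, ⟨k', a'⟩⟩ hp hp' he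
    have e (i : ℕ) := congrArg (fun w => (w.getVert i).1) he
    obtain rfl : m = m' := Sum.inr_injective (e 2)
    obtain rfl : y = y' := Sum.inl_injective (e 3)
    obtain rfl : n = n' := Sum.inr_injective (e 4)
    obtain rfl : b = b' := Sum.inl_injective (e 5)
    obtain rfl : k = k' := Sum.inr_injective (e 6)
    obtain rfl : a = a' := Sum.inl_injective (e 7)
    rfl
  · rintro w ⟨hw, hlen, hsnd⟩
    have hinj : ∀ i j, i < j → j < w.length → w.getVert i ≠ w.getVert j := fun i j hij hj he =>
      hij.ne (hw.getVert_injOn' (by simp; omega) (by simp; omega) he)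
    rw [hlen] at hinj
    obtain ⟨v1, a1, w, rfl, hlen1⟩ := w.exists_eq_cons_of_length_eq_succ hlen
    obtain ⟨v2, a2, w, rfl, hlen2⟩ := w.exists_eq_cons_of_length_eq_succ hlen1
    obtain ⟨v3, a3, w, rfl, hlen3⟩ := w.exists_eq_cons_of_length_eq_succ hlen2
    obtain ⟨v4, a4, w, rfl, hlen4⟩ := w.exists_eq_cons_of_length_eq_succ hlen3
    obtain ⟨v5, a5, w, rfl, hlen5⟩ := w.exists_eq_cons_of_length_eq_succ hlen4
    obtain ⟨v6, a6, w, rfl, hlen6⟩ := w.exists_eq_cons_of_length_eq_succ hlen5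
    obtain ⟨v7, a7, w, rfl, hlen7⟩ := w.exists_eq_cons_of_length_eq_succ hlen6
    obtain ⟨v8, a8, w, rfl, hlen8⟩ := w.exists_eq_cons_of_length_eq_succ hlen7
    obtain rfl := w.eq_of_length_eq_zero hlen8
    obtain rfl : w = .nil := by simpa using hlen8
    have hv1 : v1 = ptVertex hPe x hx := hsnd
    subst hv1
    obtain ⟨m, hm, rfl, i2⟩ := deletedGraph_adj_ptVertex hPe a2
    obtain ⟨y, hy, rfl, i3⟩ := deletedGraph_adj_lnVertex hPe a3
    obtain ⟨n, hn, rfl, i4⟩ := deletedGraph_adj_ptVertex hPe a4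
    obtain ⟨b, hb, rfl, i5⟩ := deletedGraph_adj_lnVertex hPe a5
    obtain ⟨k, hk, rfl, i6⟩ := deletedGraph_adj_ptVertex hPe a6
    obtain ⟨a, ha, rfl, i7⟩ := deletedGraph_adj_lnVertex hPe a7
    refine ⟨((m, y), (n, b), (k, a)), ⟨⟨⟨i2, hm, ?_⟩, i3, hy, ?_⟩, ⟨a8, ha, ?_⟩,
      ⟨i4, hn, ?_⟩, i7, i6, i5, hk, hb⟩, rfl⟩
    · rintro rfl; exact hinj 0 2 (by omega) (by omega) rfl
    · rintro rfl; exact hinj 1 3 (by omega) (by omega) rfl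
    · rintro rfl; exact hinj 1 7 (by omega) (by omega) rfl
    · rintro (rfl : n = m); exact hinj 2 4 (by omega) (by omega) rfl

theorem isEdgeGirthRegular_deletedGraph (h : IsGeneralizedQuadrangle I q q) (hq : 2 ≤ q)
    (hPe : I P e₀) : IsEdgeGirthRegular (deletedGraph I P e₀)
      (2 * q ^ 3) q 8 ((q - 1) ^ 2 * ((q - 2) ^ 2 + 1)) := by
  have := h.finite_points
  have := h.finite_lines
  have hinl : Function.Injective (Sum.inl : Pt → Pt ⊕ Ln) := Sum.inl_injective
  have hinr : Function.Injective (Sum.inr : Ln → Pt ⊕ Ln) := Sum.inr_injective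
  have horder : Nat.card (remaining I P e₀) = 2 * q ^ 3 := by
    have : remaining I P e₀ = Sum.inl '' {x | NonCollinear I P x} ∪
        Sum.inr '' {l | NonCollinear (fun l x => I x l) e₀ l} := by
      ext z
      constructor
      · rintro (⟨x, rfl, -, hx⟩ | ⟨l, rfl, hl⟩)
        · exact Or.inl ⟨x, hx, rfl⟩
        · exact Or.inr ⟨l, hl, rfl⟩
      · rintro (⟨x, hx, rfl⟩ | ⟨l, hl, rfl⟩)
        · exact (ptVertex hPe x hx).2
        · exact (lnVertex P l hl).2
    rw [Nat.card_coe_set_eq, this, Set.ncard_union_eq, Set.ncard_image_of_injective _ hinl,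
      Set.ncard_image_of_injective _ hinr, h.ncard_nonCollinear hPe, h.dual.ncard_nonCollinear hPe]
    · ring
    · rw [Set.disjoint_left]
      rintro _ ⟨x, -, rfl⟩ ⟨l, -, h⟩
      cases h
  have hcyc : ∀ (l : Ln) (x : Pt) (hl : NonCollinear (fun l x => I x l) e₀ l)
      (hx : NonCollinear I P x), I x l →
      {C ∈ cyclesOfLength (deletedGraph I P e₀) 8 |
        s(lnVertex P l hl, ptVertex hPe x hx) ∈ C.edgeSet}.ncard =
        (q - 1) ^ 2 * ((q - 2) ^ 2 + 1) := fun l x hl hx hxl => by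
    rw [ncard_cyclesOfLength_through, ncard_cycleWalks h hq hPe hl hx hxl]
  refine ⟨inferInstance, horder, ?_, ?_, ?_⟩
  · intro z
    rcases vertex_cases hPe z with ⟨x, hx, rfl⟩ | ⟨l, hl, rfl⟩
    · rw [← h.ncard_lines hPe hx]
      symm
      refine Set.ncard_congr (fun l hl => lnVertex P l hl.2) (fun l hl => hl.1) ?_ ?_
      · intro l l' _ _ he
        exact lnVertex_inj.1 he
      · intro z hz
        obtain ⟨l, hl, rfl, hxl⟩ := deletedGraph_adj_ptVertex hPe hz
        exact ⟨l, ⟨hxl, hl⟩, rfl⟩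
    · rw [← h.ncard_points hPe hl]
      symm
      refine Set.ncard_congr (fun x hx => ptVertex hPe x hx.2) (fun l hl => hl.1) ?_ ?_
      · intro l l' _ _ he
        exact (ptVertex_inj hPe).1 he
      · intro z hz
        obtain ⟨l, hl, rfl, hxl⟩ := deletedGraph_adj_lnVertex hPe hz
        exact ⟨l, ⟨hxl, hl⟩, rfl⟩
  -- An 8-cycle exists because the count through a flag is positive for `q ≥ 2`; shorter cycles
  -- would map injectively into the full incidence graph.
  · refine le_antisymm ?_ (SimpleGraph.le_egirth.2 fun a w hw => ?_)
    · have hne : {x | NonCollinear I P x}.ncard ≠ 0 := by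
        rw [h.ncard_nonCollinear hPe]; positivity
      obtain ⟨x, hx⟩ := Set.nonempty_of_ncard_ne_zero hne
      have hne' : {l | I x l ∧ NonCollinear (fun l x => I x l) e₀ l}.ncard ≠ 0 := by
        rw [h.ncard_lines hPe hx]; omega
      obtain ⟨l, hxl, hl⟩ := Set.nonempty_of_ncard_ne_zero hne'
      have hc := ncard_cycleWalks h hq hPe hl hx hxl
      have hpos : (q - 1) ^ 2 * ((q - 2) ^ 2 + 1) ≠ 0 := by
        have : q - 1 ≠ 0 := by omega
        positivity
      obtain ⟨w, hw, hlen, -⟩ := Set.nonempty_of_ncard_ne_zero (hc.trans_ne hpos)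
      have := hw.egirth_le_length
      rw [hlen] at this
      exact this
    · have hinj : Function.Injective
          (SimpleGraph.Embedding.induce (G := incidenceGraph I) (remaining I P e₀)).toHom :=
        Subtype.val_injective
      have := h.eight_le_length _ (hw.map hinj)
      have hlen := SimpleGraph.Walk.length_map
        (SimpleGraph.Embedding.induce (G := incidenceGraph I) (remaining I P e₀)).toHom w
      exact_mod_cast hlen ▸ this
  · intro e he
    induction e with
    | _ z z' =>
      have hadj : (deletedGraph I P e₀).Adj z z' := he
      rcases vertex_cases hPe z with ⟨x, hx, rfl⟩ | ⟨l, hl, rfl⟩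
      · obtain ⟨l, hl, rfl, hxl⟩ := deletedGraph_adj_ptVertex hPe hadj
        rw [Sym2.eq_swap]
        exact hcyc l x hl hx hxl
      · obtain ⟨x, hx, rfl, hxl⟩ := deletedGraph_adj_lnVertex hPe hadj
        exact hcyc l x hl hx hxl

end deletedGraph

theorem mainTheorem6 {Pt : Type u} {Ln : Type v} (I : Pt → Ln → Prop) (q : ℕ) (hq : 2 ≤ q)
    (hGQ : IsGeneralizedQuadrangle I q q) :
    (∀ (P : Pt) (e₀ : Ln), I P e₀ →
      IsEdgeGirthRegular (deletedGraph I P e₀)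
        (2 * q ^ 3) q 8 ((q - 1) ^ 2 * ((q - 2) ^ 2 + 1))) ∧
    (∃ (V : Type (max u v)) (G : SimpleGraph V),
      IsEdgeGirthRegular G (2 * q ^ 3) q 8 ((q - 1) ^ 2 * ((q - 2) ^ 2 + 1))) := by

  refine ⟨fun P e₀ hPe => isEdgeGirthRegular_deletedGraph hGQ hq hPe, ?_⟩
  obtain ⟨P⟩ := hGQ.nonempty_points
  have hne : {l | I P l}.ncard ≠ 0 := by rw [hGQ.lines_through_point]; omega
  obtain ⟨e₀, hPe⟩ := Set.nonempty_of_ncard_ne_zero hne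
  exact ⟨_, _, isEdgeGirthRegular_deletedGraph hGQ hq hPe⟩
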